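/- Let $n\ge 1$, let $\mathcal N$ be a set of $n$ tenants, $\mathcal M$ a set of $n$ rooms, and $R\in\mathbb R$ the total rent. For every price vector $\mathbf p\in\mathbb R^{\mathcal M}$ each tenant $i$ has a non-empty set $D_i(\mathbf p)\subseteq\mathcal M$ of best rooms. Suppose that the demands are continuous: whenever $\mathbf p^{(k)}\to\mathbf p$ and $j\in D_i(\mathbf p^{(k)})$ for all $k$, also $j\in D_i(\mathbf p)$. Suppose that the tenants are compensable: there is $T\ge R$ such that every tenant is compensable with $T$, that is, for every $\mathbf p$ with $\min_j p_j\le 0$ and $\max_j p_j=T$, every tenant $i$ has a best room $j^*\in D_i(\mathbf p)$ with $p_{j^*}<T$. Then an envy-free allocation exists: there are prices $\mathbf p\in\mathbb R^{\mathcal M}$ with $\sum_j p_j=R$ and a bijection $\sigma:\mathcal N\to\mathcal M$ with $\sigma(i)\in D_i(\mathbf p)$ for every tenant $i$. The hypotheses cover the following tenants. 1. A miserly tenant (at every $\mathbf p$ with $\min_j p_j\le 0$ the tenant has a best room $j^*$ with $p_{j^*}\le 0$) is compensable with every $T>0$. 2. A quasilinear tenant (with values $v_j\in\mathbb R$, the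 best rooms being those that maximize $v_j-p_j$) has non-empty sets of best rooms and a continuous demand, and is compensable with every $T>0$ such that $T\ge\max_j v_j-\min_j v_j$. 3. Consider a tenant whose best rooms at $\mathbf p$ are the rooms $j$ for which $(j,p_j)$ is maximal for a complete, transitive preference relation $\succeq$ on $\mathcal M\times\mathbb R$ that is continuous (closed as a set of pairs) and satisfies $(j,p)\succeq(j,p+\delta)$ for $\delta\ge 0$. Such a tenant has non-empty sets of best rooms and a continuous demand. If the tenant is Archimedean with $T$ (that is, $(j,0)\succeq(j',T)$ for all rooms $j,j'$), then the tenant is compensable with every $T'\ge T$ such that $T'>0$. -/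

import Mathlib

open Filter Topology

/-- The demand of a tenant over the rooms `M`: to each price vector it assigns the set of
best rooms of the tenant at these prices. -/
abbrev Demand (M : Type*) := (M → ℝ) → Set M

namespace Demand

variable {M : Type*}

/-- The tenant has one or more best rooms at every price vector. -/
def HasBestRooms (d : Demand M) : Prop :=
  ∀ p : M → ℝ, (d p).Nonempty

/-- If a room is a best room along a convergent sequence of price vectors, then it is a best
room at the limit. -/
def IsContinuous (d : Demand M) : Prop :=
  ∀ (j : M) (p : ℕ → M → ℝ) (q : M → ℝ),
    Tendsto p atTop (𝓝 q) → (∀ k, j ∈ d (p k)) → j ∈ d q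

/-- Whenever some room costs at most `0` and the most expensive room costs `T`, the tenant
has a best room costing less than `T`. -/
def CompensableWith (T : ℝ) (d : Demand M) : Prop :=
  ∀ p : M → ℝ, (∃ j, p j ≤ 0) → IsGreatest (Set.range p) T → ∃ j ∈ d p, p j < T

/-- Whenever some room costs at most `0`, the tenant has a best room costing at most `0`. -/
def Miserly (d : Demand M) : Prop :=
  ∀ p : M → ℝ, (∃ j, p j ≤ 0) → ∃ j ∈ d p, p j ≤ 0

/-- The demand of the quasilinear tenant with value `v j` for room `j`. -/
def quasilinear (v : M → ℝ) : Demand M :=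
  fun p => {j | ∀ k, v k - p k ≤ v j - p j}

/-- The demand of a tenant with the preference relation `r` on pairs (room, price), where
`r a b` means that `a` is weakly preferred to `b`. -/
def ofPreference (r : M × ℝ → M × ℝ → Prop) : Demand M :=
  fun p => {j | ∀ k, r (j, p j) (k, p k)}

end Demand

/-- `r` (with `r a b` read as "`a` is weakly preferred to `b`") is a complete and transitive
preference relation on pairs (room, price) that is continuous and monotonic in the price. -/
structure IsPricePreference {M : Type*} (r : M × ℝ → M × ℝ → Prop) : Prop where
  complete : ∀ a b, r a b ∨ r b a
  trans : ∀ a b c, r a b → r b c → r a c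
  continuous : ∀ j k : M, IsClosed {x : ℝ × ℝ | r (j, x.1) (k, x.2)}
  monotone : ∀ (j : M) (p δ : ℝ), 0 ≤ δ → r (j, p) (j, p + δ)

/-- Every free room is weakly preferred to every room that costs `T`. -/
def ArchimedeanWith {M : Type*} (T : ℝ) (r : M × ℝ → M × ℝ → Prop) : Prop :=
  ∀ j k : M, r (j, 0) (k, T)

/-- The tenants with demands `D` are compensable for the total rent `R`: one number `T ≥ R`
works for all of them. -/
def Compensable {N M : Type*} (R : ℝ) (D : N → Demand M) : Prop :=
  ∃ T : ℝ, R ≤ T ∧ ∀ i, (D i).CompensableWith T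

/-- Prices `p` of total `R` and an assignment `σ` of the rooms to the tenants, one room to
each, such that every tenant receives one of his or her best rooms. -/
def IsEnvyFree {N M : Type*} [Fintype M] (R : ℝ) (D : N → Demand M) (p : M → ℝ)
    (σ : N ≃ M) : Prop :=
  ∑ j, p j = R ∧ ∀ i, σ i ∈ D i p

/-! With at least two rooms, the prices of total `R` that are at most `T` are parametrized by the
simplex through `p j = T - c * x j`, so that room `j` costs `T` exactly when `x j = 0`. If some room
costs `T ≥ R`, the others total at most `0`, so one of them costs at most `0` and compensability
yields a best room with `x j > 0`. Each tenant's demand is thus a closed KKM cover, and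
`exists_equiv_forall_mem_of_kkm` picks distinct best rooms at a common point.

For that theorem the covers are smoothed into row-stochastic matrices `A x`. The average of the rows
preserves faces, so it attains the barycentre (`exists_eq_barycentre_of_preserves_faces`, from
Brouwer). There `A x` is doubly stochastic, and Birkhoff's theorem gives the assignment up to an
error that compactness removes.

Brouwer follows from Poincaré–Miranda, whose discrete form is a mod 2 Stokes argument: the cup
product of the coboundaries of the labels, summed over Kuhn's triangulation, depends only on the
labels on the faces (`kuhnSum_cupCoboundary_congr`) and is `1` for threshold labels. A nonzero term
is a cell in which every label changes. -/

/-! ### A discrete Poincaré–Miranda theorem -/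

/-- The `m`-th vertex of the monotone lattice path that starts at `v` and increases each
coordinate once, coordinate `i` being increased in step `σ i`. -/
def pathVertex {n k : ℕ} (v : Fin n → Fin k) (σ : Equiv.Perm (Fin n)) (m : ℕ) : Fin n → ℕ :=
  fun i => v i + if (σ i : ℕ) < m then 1 else 0

/-- The sum of `F` over all simplices of Kuhn's triangulation of the cube `[0, k]ⁿ`. -/
def kuhnSum (n k : ℕ) (F : (ℕ → Fin n → ℕ) → ZMod 2) : ZMod 2 :=
  ∑ σ : Equiv.Perm (Fin n), ∑ v : Fin n → Fin k, F (pathVertex v σ)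

lemma kuhnSum_sub {n k : ℕ} (F G : (ℕ → Fin n → ℕ) → ZMod 2) :
    kuhnSum n k (fun y => F y - G y) = kuhnSum n k F - kuhnSum n k G := by
  simp [kuhnSum, Finset.sum_sub_distrib]

/-- Exchanging steps `m - 1` and `m` of a lattice path moves only its vertex `m`. -/
lemma swap_pred_lt_iff {n m t : ℕ} (hm : 0 < m) (hmn : m < n) (ht : t ≠ m) (j : Fin n) :
    ((Equiv.swap (⟨m - 1, by omega⟩ : Fin n) ⟨m, hmn⟩ j : Fin n) : ℕ) < t ↔ (j : ℕ) < t := by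
  rw [Equiv.swap_apply_def]
  split_ifs with h1 h2
  · subst h1; simp only; omega
  · subst h2; simp only; omega
  · rfl

/-- A function of the simplices that ignores an interior vertex has sum zero, since each face
opposite to such a vertex lies in exactly two simplices. -/
lemma kuhnSum_eq_zero_of_interior {n k m : ℕ} (hm : 0 < m) (hmn : m < n)
    (F : (ℕ → Fin n → ℕ) → ZMod 2)
    (hF : ∀ y y' : ℕ → Fin n → ℕ, (∀ t, t ≠ m → y t = y' t) → F y = F y') :
    kuhnSum n k F = 0 := by
  unfold kuhnSum
  rw [Finset.sum_comm]
  refine Finset.sum_eq_zero fun v _ => ?_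
  set τ : Equiv.Perm (Fin n) := Equiv.swap (⟨m - 1, by omega⟩ : Fin n) ⟨m, hmn⟩ with hτ
  have hne : (⟨m - 1, by omega⟩ : Fin n) ≠ ⟨m, hmn⟩ := by
    intro h; simp only [Fin.mk.injEq] at h; omega
  refine Finset.sum_ninvolution (fun σ => τ * σ) ?_ ?_ (by simp) ?_
  · intro σ
    have : F (pathVertex v (τ * σ)) = F (pathVertex v σ) := by
      refine hF _ _ fun t ht => ?_
      funext i
      simp only [pathVertex, Equiv.Perm.mul_apply, hτ, swap_pred_lt_iff hm hmn ht]
    rw [this]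
    exact CharTwo.add_self_eq_zero _
  · intro σ _ h
    have h1 : τ = 1 := by simpa using h
    rw [hτ] at h1
    exact hne (Equiv.swap_eq_one_iff.1 h1)
  · intro σ
    rw [← mul_assoc, hτ, Equiv.swap_mul_self, one_mul]

/-- The factor for index `j` of a cup product of `0`-cochains `a j`, all of them replaced by their
coboundaries except for `a i`; the argument `t` is the position of the factor in the path. -/
def cupFactor {n : ℕ} (a : Fin n → (Fin n → ℕ) → ZMod 2) (i : Fin n) (y : ℕ → Fin n → ℕ)
    (t : ℕ) (j : Fin n) : ZMod 2 :=
  if j < i then a j (y (t + 1)) - a j (y t)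
  else if j = i then a j (y t)
  else a j (y t) - a j (y (t - 1))

/-- The cup product with the factors from index `m` on shifted by one step. -/
def shiftedCup {n : ℕ} (a : Fin n → (Fin n → ℕ) → ZMod 2) (i : Fin n) (m : ℕ)
    (y : ℕ → Fin n → ℕ) : ZMod 2 :=
  ∏ j : Fin n, cupFactor a i y (if m ≤ j then j + 1 else j) j

/-- The cup product of the coboundaries of the `0`-cochains `a j`. -/
def cupCoboundary {n : ℕ} (a : Fin n → (Fin n → ℕ) → ZMod 2) (y : ℕ → Fin n → ℕ) : ZMod 2 :=
  ∏ j : Fin n, (a j (y (j + 1)) - a j (y j))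

lemma shiftedCup_sub_succ {n : ℕ} (a : Fin n → (Fin n → ℕ) → ZMod 2) (i m : Fin n)
    (y : ℕ → Fin n → ℕ) :
    shiftedCup a i m y - shiftedCup a i (m + 1) y =
      (cupFactor a i y (m + 1) m - cupFactor a i y m m) *
        ∏ j ∈ Finset.univ.erase m, cupFactor a i y (if (m : ℕ) ≤ j then j + 1 else j) j := by
  unfold shiftedCup
  rw [← Finset.mul_prod_erase _ _ (Finset.mem_univ m),
    ← Finset.mul_prod_erase (a := m) Finset.univ
      (fun j : Fin n => cupFactor a i y (if (m : ℕ) + 1 ≤ j then j + 1 else j) j)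
      (Finset.mem_univ m)]
  have h : ∏ j ∈ Finset.univ.erase m,
        cupFactor a i y (if (m : ℕ) + 1 ≤ j then (j : ℕ) + 1 else j) j =
      ∏ j ∈ Finset.univ.erase m, cupFactor a i y (if (m : ℕ) ≤ j then (j : ℕ) + 1 else j) j := by
    refine Finset.prod_congr rfl fun j hj => ?_
    have hjm : (j : ℕ) ≠ m := fun h => Finset.ne_of_mem_erase hj (Fin.ext h)
    have : ((m : ℕ) + 1 ≤ j) ↔ ((m : ℕ) ≤ j) := by omega
    simp only [this]
  rw [h]
  simp only [le_refl, if_true, Nat.not_succ_le_self, if_false]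
  ring

/-- Only factor `m` differs. Mod 2, the difference of its two consecutive increments loses the
middle vertex, which no other factor uses, so `kuhnSum_eq_zero_of_interior` applies. -/
lemma kuhnSum_shiftedCup_succ {n k : ℕ} (a : Fin n → (Fin n → ℕ) → ZMod 2) (i m : Fin n)
    (hm : m ≠ i) :
    kuhnSum n k (shiftedCup a i m) = kuhnSum n k (shiftedCup a i (m + 1)) := by
  rw [← sub_eq_zero, ← kuhnSum_sub]
  have hne : (m : ℕ) ≠ i := fun h => hm (Fin.ext h)
  have hin := i.2
  have hmn := m.2
  -- The factors before `i` look one vertex ahead and those after `i` one vertex back, hence the two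
  -- cases.
  refine kuhnSum_eq_zero_of_interior (m := if m < i then m + 1 else m) ?_ ?_ _ ?_
  · split_ifs with h
    · omega
    · rw [Fin.lt_def] at h; omega
  · split_ifs with h
    · rw [Fin.lt_def] at h; omega
    · omega
  · intro y y' hy
    rw [shiftedCup_sub_succ, shiftedCup_sub_succ]
    have h2 : ∀ x : ZMod 2, x + x = 0 := CharTwo.add_self_eq_zero
    congr 1
    · unfold cupFactor
      by_cases h : m < i
      · simp only [if_pos h] at hy ⊢
        rw [hy (m + 1 + 1) (by omega), hy m (by omega)]
        linear_combination -h2 (a m (y (m + 1))) + h2 (a m (y' (m + 1)))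
      · simp only [if_neg h, if_neg hm] at hy ⊢
        rw [Fin.lt_def] at h
        rw [hy (m + 1) (by omega), hy (m - 1) (by omega), Nat.add_sub_cancel]
        linear_combination -h2 (a m (y m)) + h2 (a m (y' m))
    · refine Finset.prod_congr rfl fun j hj => ?_
      have hjm : (j : ℕ) ≠ m := fun h => Finset.ne_of_mem_erase hj (Fin.ext h)
      unfold cupFactor
      simp only [Fin.lt_def, Fin.ext_iff] at hy ⊢
      split_ifs at hy ⊢ <;>
        first
        | rw [hy _ (by omega), hy _ (by omega)]
        | rw [hy _ (by omega)]

/-- The Leibniz rule: the one shift that does not cancel in the sum turns `a i` into its coboundary.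
-/
lemma shiftedCup_sub_self {n : ℕ} (a : Fin n → (Fin n → ℕ) → ZMod 2) (i : Fin n)
    (y : ℕ → Fin n → ℕ) :
    shiftedCup a i i y - shiftedCup a i (i + 1) y = cupCoboundary a y := by
  rw [shiftedCup_sub_succ, cupCoboundary, ← Finset.mul_prod_erase _ _ (Finset.mem_univ i)]
  congr 1
  · simp [cupFactor]
  · refine Finset.prod_congr rfl fun j hj => ?_
    have hji : (j : ℕ) ≠ i := fun h => Finset.ne_of_mem_erase hj (Fin.ext h)
    unfold cupFactor
    simp only [Fin.lt_def, Fin.ext_iff, hji, if_false]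
    split_ifs <;> first | omega | rfl

lemma shiftedCup_zero {n : ℕ} (a : Fin n → (Fin n → ℕ) → ZMod 2) (i : Fin n)
    (y : ℕ → Fin n → ℕ) :
    shiftedCup a i 0 y = shiftedCup a i n (fun t => y (t + 1)) := by
  refine Finset.prod_congr rfl fun j _ => ?_
  have := j.2
  unfold cupFactor
  simp only [Fin.lt_def, Fin.ext_iff, zero_le, if_true, if_neg (not_le.2 j.2)]
  split_ifs
  · rfl
  · rfl
  · rw [show (j : ℕ) + 1 - 1 = j - 1 + 1 by omega]

lemma shiftedCup_congr {n : ℕ} (a : Fin n → (Fin n → ℕ) → ZMod 2) (i : Fin n)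
    {y y' : ℕ → Fin n → ℕ} (h : ∀ t < n, y t = y' t) :
    shiftedCup a i n y = shiftedCup a i n y' := by
  refine Finset.prod_congr rfl fun j _ => ?_
  have h1 := j.2
  have h2 := i.2
  unfold cupFactor
  simp only [Fin.lt_def, Fin.ext_iff, if_neg (not_le.2 j.2)]
  split_ifs
  · rw [h _ (by omega), h _ (by omega)]
  · rw [h _ (by omega)]
  · rw [h _ (by omega), h _ (by omega)]

/-- On a face of the cube the `0`-cochain of the corresponding coordinate is constant. -/
def ConstOnFaces {n : ℕ} (k : ℕ) (a : Fin n → (Fin n → ℕ) → ZMod 2) (c d : Fin n → ZMod 2) :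
    Prop :=
  ∀ j x, (x j = 0 → a j x = c j) ∧ (x j = k → a j x = d j)

/-- Factor `l` is the coboundary of a cochain constant on the face or, if `l = i`, the value `0`
itself. -/
lemma shiftedCup_eq_zero_of_face {n k : ℕ} {a : Fin n → (Fin n → ℕ) → ZMod 2}
    {c d : Fin n → ZMod 2} (ha : ConstOnFaces k a c d) {i : Fin n} (hc : c i = 0) (hd : d i = 0)
    {y : ℕ → Fin n → ℕ} {l : Fin n}
    (hy : (∀ t < n, y t l = 0) ∨ (∀ t < n, y t l = k)) : shiftedCup a i n y = 0 := by
  refine Finset.prod_eq_zero (Finset.mem_univ l) ?_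
  have hl := l.2
  have hi := i.2
  obtain ⟨e, he, he'⟩ : ∃ e, (∀ t < n, a l (y t) = e) ∧ (l = i → e = 0) := by
    rcases hy with hy | hy
    · exact ⟨c l, fun t ht => (ha l _).1 (hy t ht), fun h => h ▸ hc⟩
    · exact ⟨d l, fun t ht => (ha l _).2 (hy t ht), fun h => h ▸ hd⟩
  unfold cupFactor
  simp only [if_neg (not_le.2 l.2)]
  split_ifs with h1 h2
  · rw [Fin.lt_def] at h1
    rw [he _ (by omega), he _ (by omega), sub_self]
  · rw [he _ hl, he' h2]
  · rw [he _ (by omega), he _ (by omega), sub_self]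

/-- A path without its first vertex is another path without its last: start one step later and take
the first step last. This matches the facets on the two sides. -/
lemma kuhnSum_shiftedCup_rotate {n k : ℕ} {a : Fin n → (Fin n → ℕ) → ZMod 2}
    {c d : Fin n → ZMod 2} (ha : ConstOnFaces k a c d) {i : Fin n} (hc : c i = 0)
    (hd : d i = 0) :
    kuhnSum n k (shiftedCup a i 0) = kuhnSum n k (shiftedCup a i n) := by
  obtain ⟨n, rfl⟩ : ∃ n', n = n' + 1 := ⟨n - 1, by have := i.2; omega⟩
  rcases k with _ | k
  · simp [kuhnSum]
  unfold kuhnSum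
  rw [← Equiv.sum_comp (Equiv.mulLeft (finRotate (n + 1))⁻¹)
    (fun σ => ∑ v : Fin (n + 1) → Fin (k + 1), shiftedCup a i (n + 1) (pathVertex v σ))]
  refine Finset.sum_congr rfl fun σ _ => ?_
  rw [← Equiv.sum_comp (Equiv.piCongrRight fun l : Fin (n + 1) =>
    if σ l = 0 then finRotate (k + 1) else Equiv.refl _)
    (fun v => shiftedCup a i (n + 1) (pathVertex v _))]
  refine Finset.sum_congr rfl fun v _ => ?_
  rw [shiftedCup_zero, Equiv.coe_mulLeft]
  obtain ⟨l, hl⟩ := σ.surjective 0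
  have hrot : ∀ j : Fin (n + 1), (((finRotate (n + 1))⁻¹ j : Fin (n + 1)) : ℕ) =
      if j = 0 then n else j - 1 := by
    intro j
    obtain ⟨j, rfl⟩ := (finRotate (n + 1)).surjective j
    rw [Equiv.Perm.inv_def, Equiv.symm_apply_apply]
    by_cases hj : j = Fin.last n
    · subst hj; simp
    · have h := coe_finRotate_of_ne_last hj
      have h0 : finRotate (n + 1) j ≠ 0 := by
        intro h'; rw [h'] at h; simp at h
      rw [if_neg h0, h, Nat.add_sub_cancel]
  -- Here the later start would leave the cube and `finRotate` wraps it around. The two facets then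
  -- lie on opposite faces of the cube, and both terms vanish.
  by_cases hv : v l = Fin.last k
  · rw [shiftedCup_eq_zero_of_face ha hc hd (l := l), shiftedCup_eq_zero_of_face ha hc hd (l := l)]
    · left
      intro t ht
      have : ¬ n < t := by omega
      simp [pathVertex, hl, hv, this]
    · right
      intro t ht
      simp [pathVertex, hl, hv]
  · refine shiftedCup_congr a i fun t ht => ?_
    funext r
    have hnt : ¬ n < t := by omega
    by_cases hr : σ r = 0
    · obtain rfl : r = l := σ.injective (hr.trans hl.symm)
      have hvr := coe_finRotate_of_ne_last hv
      rw [finRotate_apply] at hvr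
      simp [pathVertex, hl, hnt, hvr]
    · have hr' : (σ r : ℕ) ≠ 0 := fun h => hr (Fin.ext h)
      have : (σ r : ℕ) < t + 1 ↔ (σ r : ℕ) - 1 < t := by omega
      simp only [pathVertex, Equiv.Perm.mul_apply, hrot, hr, if_false, Equiv.piCongrRight_apply,
        Pi.map_apply, Equiv.refl_apply, this]

/-- Stokes: by `shiftedCup_sub_self` the sum is a difference of the shifts `i` and `i + 1`, which
equal the shifts `0` and `n`, and these agree by rotation. -/
lemma kuhnSum_cupCoboundary_eq_zero {n k : ℕ} {a : Fin n → (Fin n → ℕ) → ZMod 2}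
    {c d : Fin n → ZMod 2} (ha : ConstOnFaces k a c d) {i : Fin n} (hc : c i = 0)
    (hd : d i = 0) : kuhnSum n k (cupCoboundary a) = 0 := by
  have hlow : ∀ m : ℕ, m ≤ i →
      kuhnSum n k (shiftedCup a i 0) = kuhnSum n k (shiftedCup a i m) := by
    intro m
    induction m with
    | zero => intro _; rfl
    | succ m ih =>
      intro hm
      have hi := i.2
      rw [ih (by omega)]
      exact kuhnSum_shiftedCup_succ a i ⟨m, by omega⟩ (by
        intro h; rw [← h] at hm; simp at hm)
  have hhigh : ∀ m : ℕ, (i : ℕ) + 1 ≤ m → m ≤ n →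
      kuhnSum n k (shiftedCup a i (i + 1)) = kuhnSum n k (shiftedCup a i m) := by
    intro m hm
    induction m, hm using Nat.le_induction with
    | base => intro _; rfl
    | succ m hm ih =>
      intro hmn
      rw [ih (by omega)]
      exact kuhnSum_shiftedCup_succ a i ⟨m, by omega⟩ (by
        intro h; rw [← h] at hm; simp at hm)
  have hfun : cupCoboundary a = fun y => shiftedCup a i i y - shiftedCup a i (i + 1) y := by
    funext y; rw [shiftedCup_sub_self]
  rw [hfun, kuhnSum_sub, ← hlow i le_rfl, hhigh n i.2 le_rfl, kuhnSum_shiftedCup_rotate ha hc hd,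
    sub_self]

/-- By multilinearity the difference is a cup product whose `i`-th cochain `a i - b i` vanishes on
both of its faces. -/
lemma kuhnSum_cupCoboundary_update {n k : ℕ} {a b : Fin n → (Fin n → ℕ) → ZMod 2}
    {c d : Fin n → ZMod 2} (ha : ConstOnFaces k a c d) (hb : ConstOnFaces k b c d) (i : Fin n)
    (hab : ∀ j, j ≠ i → a j = b j) :
    kuhnSum n k (cupCoboundary a) = kuhnSum n k (cupCoboundary b) := by
  rw [← sub_eq_zero, ← kuhnSum_sub]
  have hfun : (fun y => cupCoboundary a y - cupCoboundary b y) =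
      cupCoboundary (Function.update a i (a i - b i)) := by
    funext y
    unfold cupCoboundary
    have key : ∀ f : Fin n → (Fin n → ℕ) → ZMod 2, (∀ j, j ≠ i → f j = a j) →
        ∏ j : Fin n, (f j (y (j + 1)) - f j (y j)) = (f i (y (i + 1)) - f i (y i)) *
          ∏ j ∈ Finset.univ.erase i, (a j (y (j + 1)) - a j (y j)) := by
      intro f hf
      rw [← Finset.mul_prod_erase _ _ (Finset.mem_univ i)]
      congr 1
      exact Finset.prod_congr rfl fun j hj => by rw [hf j (Finset.ne_of_mem_erase hj)]
    rw [key a fun _ _ => rfl, key b fun j hj => (hab j hj).symm,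
      key (Function.update a i (a i - b i)) fun j hj => by simp [hj]]
    simp only [Function.update_self, Pi.sub_apply]
    ring
  rw [hfun]
  refine kuhnSum_cupCoboundary_eq_zero (c := Function.update c i 0) (d := Function.update d i 0)
    (i := i) ?_ (by simp) (by simp)
  intro j x
  by_cases hj : j = i
  · subst hj
    simp only [Function.update_self, Pi.sub_apply]
    exact ⟨fun h => by rw [(ha j x).1 h, (hb j x).1 h, sub_self],
      fun h => by rw [(ha j x).2 h, (hb j x).2 h, sub_self]⟩
  · simpa [hj] using ha j x

lemma kuhnSum_cupCoboundary_congr {n k : ℕ} {a b : Fin n → (Fin n → ℕ) → ZMod 2}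
    {c d : Fin n → ZMod 2} (ha : ConstOnFaces k a c d) (hb : ConstOnFaces k b c d) :
    kuhnSum n k (cupCoboundary a) = kuhnSum n k (cupCoboundary b) := by
  have hmix : ∀ s : Finset (Fin n), ConstOnFaces k (fun j => if j ∈ s then b j else a j) c d := by
    intro s j x
    dsimp only
    split_ifs
    · exact hb j x
    · exact ha j x
  have key : ∀ s : Finset (Fin n), kuhnSum n k (cupCoboundary a) =
      kuhnSum n k (cupCoboundary fun j => if j ∈ s then b j else a j) := by
    intro s
    induction s using Finset.induction_on with
    | empty => simp
    | insert i s _ ih =>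
      rw [ih]
      exact kuhnSum_cupCoboundary_update (hmix _) (hmix _) i fun j hj => by
        simp [Finset.mem_insert, hj]
  simpa using key Finset.univ

/-- The sum for the reference cochains `x ↦ [k ≤ x j]`, where only one simplex contributes. -/
lemma kuhnSum_cupCoboundary_threshold (n k : ℕ) :
    kuhnSum n (k + 1) (cupCoboundary fun j x => if k + 1 ≤ x j then 1 else 0) = 1 := by
  unfold kuhnSum
  have hterm : ∀ (σ : Equiv.Perm (Fin n)) (v : Fin n → Fin (k + 1)),
      cupCoboundary (fun j x => if k + 1 ≤ x j then 1 else 0) (pathVertex v σ) ≠ 0 →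
        σ = 1 ∧ v = fun _ => Fin.last k := by
    intro σ v h
    have hj : ∀ j : Fin n, (σ j : ℕ) = j ∧ v j = Fin.last k := by
      intro j
      have h1 := Finset.prod_ne_zero_iff.1 h j (Finset.mem_univ j)
      have h2 := (v j).2
      simp only [pathVertex] at h1
      rw [Fin.ext_iff, Fin.val_last]
      split_ifs at h1 <;> first | omega | simp at h1
    exact ⟨Equiv.ext fun j => Fin.ext (hj j).1, funext fun j => (hj j).2⟩
  rw [Finset.sum_eq_single (1 : Equiv.Perm (Fin n)), Finset.sum_eq_single fun _ => Fin.last k]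
  · simp [cupCoboundary, pathVertex]
  · intro v _ hv
    by_contra h
    exact hv (hterm _ _ h).2
  · simp
  · intro σ _ hσ
    refine Finset.sum_eq_zero fun v _ => ?_
    by_contra h
    exact hσ (hterm _ _ h).1
  · simp

/-- **Discrete Poincaré–Miranda theorem.** If the two-valued functions `a j` on the grid
`{0, …, k + 1}ⁿ` are `0` where coordinate `j` is `0` and `1` where it is `k + 1`, then there is a
cell of the grid on whose vertices every `a j` takes both values. -/
theorem exists_cell_forall_changes {n k : ℕ} (a : Fin n → (Fin n → ℕ) → ZMod 2)
    (h0 : ∀ j x, x j = 0 → a j x = 0) (h1 : ∀ j x, x j = k + 1 → a j x = 1) :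
    ∃ (v : Fin n → Fin (k + 1)) (σ : Equiv.Perm (Fin n)), ∀ j : Fin n,
      a j (pathVertex v σ (j + 1)) ≠ a j (pathVertex v σ j) := by
  have ha : ConstOnFaces (k + 1) a 0 1 := fun j x => ⟨h0 j x, h1 j x⟩
  have hb : ConstOnFaces (n := n) (k + 1) (fun j x => if k + 1 ≤ x j then 1 else 0) 0 1 :=
    fun j x => ⟨fun h => by simp [h], fun h => by simp [h]⟩
  have hne : kuhnSum n (k + 1) (cupCoboundary a) ≠ 0 := by
    rw [kuhnSum_cupCoboundary_congr ha hb, kuhnSum_cupCoboundary_threshold]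
    exact one_ne_zero
  obtain ⟨σ, -, hσ⟩ := Finset.exists_ne_zero_of_sum_ne_zero hne
  obtain ⟨v, -, hv⟩ := Finset.exists_ne_zero_of_sum_ne_zero hσ
  exact ⟨v, σ, fun j => sub_ne_zero.1 (Finset.prod_ne_zero_iff.1 hv j (Finset.mem_univ j))⟩

/-! ### The theorems of Poincaré–Miranda and Brouwer -/

/-- The grid point of the unit cube with integer coordinates `x` at mesh `1 / (k + 1)`. -/
noncomputable def gridPoint {n : ℕ} (k : ℕ) (x : Fin n → ℕ) : Fin n → ℝ :=
  fun i => (x i : ℝ) / (k + 1)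

lemma gridPoint_pathVertex_mem {n k : ℕ} (v : Fin n → Fin (k + 1)) (σ : Equiv.Perm (Fin n))
    (m : ℕ) : gridPoint k (pathVertex v σ m) ∈ Set.Icc (0 : Fin n → ℝ) 1 := by
  refine ⟨fun i => ?_, fun i => ?_⟩
  · simp only [gridPoint, Pi.zero_apply]; positivity
  · simp only [gridPoint, Pi.one_apply]
    rw [div_le_one (by positivity)]
    have h1 := (v i).2
    have : pathVertex v σ m i ≤ k + 1 := by
      simp only [pathVertex]; split_ifs <;> omega
    exact_mod_cast this

lemma dist_gridPoint_pathVertex_le {n k : ℕ} (v : Fin n → Fin (k + 1)) (σ : Equiv.Perm (Fin n))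
    (m m' : ℕ) :
    dist (gridPoint k (pathVertex v σ m)) (gridPoint k (pathVertex v σ m')) ≤ 1 / (k + 1) := by
  refine (dist_pi_le_iff (by positivity)).2 fun i => ?_
  simp only [gridPoint]
  rw [Real.dist_eq, ← sub_div, abs_div, abs_of_pos (by positivity : (0 : ℝ) < k + 1)]
  gcongr
  simp only [pathVertex, Nat.cast_add]
  split_ifs <;> simp

lemma exists_near_sign_changes {n : ℕ} (f : (Fin n → ℝ) → Fin n → ℝ)
    (h0 : ∀ x ∈ Set.Icc (0 : Fin n → ℝ) 1, ∀ i, x i = 0 → f x i ≤ 0)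
    (h1 : ∀ x ∈ Set.Icc (0 : Fin n → ℝ) 1, ∀ i, x i = 1 → 0 ≤ f x i) (k : ℕ) :
    ∃ z ∈ Set.Icc (0 : Fin n → ℝ) 1, ∀ i,
      (∃ p ∈ Set.Icc (0 : Fin n → ℝ) 1, dist p z ≤ 1 / (k + 1) ∧ f p i ≤ 0) ∧
      ∃ q ∈ Set.Icc (0 : Fin n → ℝ) 1, dist q z ≤ 1 / (k + 1) ∧ 0 ≤ f q i := by
  classical
  -- The face values are imposed rather than read off from `f`, which may vanish on the face `x i =
  -- 1` and has no known sign outside the cube.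
  set a : Fin n → (Fin n → ℕ) → ZMod 2 := fun i x =>
    if x i = 0 then 0 else if x i = k + 1 then 1 else
      if 0 < f (gridPoint k x) i then 1 else 0 with ha
  obtain ⟨v, σ, h⟩ := exists_cell_forall_changes (k := k) a (fun j x hx => by simp [ha, hx])
    (fun j x hx => by simp [ha, hx])
  have hk : (k : ℝ) + 1 ≠ 0 := by positivity
  have hle : ∀ i m, a i (pathVertex v σ m) = 0 → f (gridPoint k (pathVertex v σ m)) i ≤ 0 := by
    intro i m hm
    simp only [ha] at hm
    split_ifs at hm with h2 h3 h4
    · exact h0 _ (gridPoint_pathVertex_mem v σ m) i (by simp [gridPoint, h2])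
    · simp at hm
    · simp at hm
    · exact not_lt.1 h4
  have hge : ∀ i m, a i (pathVertex v σ m) ≠ 0 → 0 ≤ f (gridPoint k (pathVertex v σ m)) i := by
    intro i m hm
    simp only [ha] at hm
    split_ifs at hm with h2 h3 h4
    · simp at hm
    · exact h1 _ (gridPoint_pathVertex_mem v σ m) i (by simp [gridPoint, h3, hk])
    · exact h4.le
    · simp at hm
  refine ⟨gridPoint k (pathVertex v σ 0), gridPoint_pathVertex_mem v σ 0, fun i => ?_⟩
  have hmem := gridPoint_pathVertex_mem v σ
  have hdist := fun m => dist_gridPoint_pathVertex_le v σ m 0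
  by_cases hi : a i (pathVertex v σ i) = 0
  · exact ⟨⟨_, hmem _, hdist _, hle i _ hi⟩, _, hmem _, hdist _,
      hge i (i + 1) fun h' => h i (h'.trans hi.symm)⟩
  · have hi' : a i (pathVertex v σ (i + 1)) = 0 := by
      have hz : ∀ x y : ZMod 2, x ≠ y → y ≠ 0 → x = 0 := by decide
      exact hz _ _ (h i) hi
    exact ⟨⟨_, hmem _, hdist _, hle i _ hi'⟩, _, hmem _, hdist _, hge i _ hi⟩

/-- **Poincaré–Miranda theorem.** -/
theorem exists_eq_zero_of_opposite_faces {n : ℕ} (f : (Fin n → ℝ) → Fin n → ℝ)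
    (hf : ContinuousOn f (Set.Icc 0 1))
    (h0 : ∀ x ∈ Set.Icc (0 : Fin n → ℝ) 1, ∀ i, x i = 0 → f x i ≤ 0)
    (h1 : ∀ x ∈ Set.Icc (0 : Fin n → ℝ) 1, ∀ i, x i = 1 → 0 ≤ f x i) :
    ∃ z ∈ Set.Icc (0 : Fin n → ℝ) 1, f z = 0 := by
  choose z hz hpq using exists_near_sign_changes f h0 h1
  choose hp hq using hpq
  choose p hp hpz hfp using hp
  choose q hq hqz hfq using hq
  obtain ⟨w, hw, φ, hφ, hlim⟩ := isCompact_Icc.tendsto_subseq hz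
  have hmesh : Tendsto (fun m => 1 / ((φ m : ℝ) + 1)) atTop (𝓝 0) :=
    tendsto_one_div_add_atTop_nhds_zero_nat.comp hφ.tendsto_atTop
  have hnear : ∀ r : ℕ → Fin n → ℝ, (∀ k, r k ∈ Set.Icc (0 : Fin n → ℝ) 1) →
      (∀ k, dist (r k) (z k) ≤ 1 / (k + 1)) → Tendsto (fun m => f (r (φ m))) atTop (𝓝 (f w)) := by
    intro r hr hrz
    have hrw : Tendsto (fun m => r (φ m)) atTop (𝓝 w) := by
      refine hlim.congr_dist ?_
      refine squeeze_zero (fun _ => dist_nonneg) (fun m => ?_) hmesh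
      rw [dist_comm]
      exact hrz (φ m)
    exact (hf w hw).tendsto.comp (tendsto_nhdsWithin_iff.2
      ⟨hrw, Eventually.of_forall fun m => hr (φ m)⟩)
  refine ⟨w, hw, funext fun i => le_antisymm ?_ ?_⟩
  · exact le_of_tendsto ((continuous_apply i).continuousAt.tendsto.comp
      (hnear (fun k => p k i) (fun k => hp k i) (fun k => hpz k i)))
      (Eventually.of_forall fun m => hfp (φ m) i)
  · exact ge_of_tendsto ((continuous_apply i).continuousAt.tendsto.comp
      (hnear (fun k => q k i) (fun k => hq k i) (fun k => hqz k i)))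
      (Eventually.of_forall fun m => hfq (φ m) i)

/-- **Brouwer's fixed point theorem** for the cube. -/
theorem exists_fixedPoint_of_mapsTo_Icc {M : Type*} [Fintype M] (h : (M → ℝ) → M → ℝ)
    (hc : ContinuousOn h (Set.Icc 0 1)) (hm : Set.MapsTo h (Set.Icc 0 1) (Set.Icc 0 1)) :
    ∃ x ∈ Set.Icc (0 : M → ℝ) 1, h x = x := by
  let e := Fintype.equivFin M
  have hmem : ∀ x ∈ Set.Icc (0 : Fin (Fintype.card M) → ℝ) 1,
      (fun j => x (e j)) ∈ Set.Icc (0 : M → ℝ) 1 :=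
    fun x hx => ⟨fun j => hx.1 (e j), fun j => hx.2 (e j)⟩
  have key := exists_eq_zero_of_opposite_faces
    (fun x i => x i - h (fun j => x (e j)) (e.symm i)) ?_ ?_ ?_
  · obtain ⟨z, hz, hfz⟩ := key
    refine ⟨_, hmem z hz, funext fun j => ?_⟩
    have := congrFun hfz (e j)
    simp only [Equiv.symm_apply_apply, Pi.zero_apply] at this
    linarith
  · refine continuousOn_pi.2 fun i => (continuous_apply i).continuousOn.sub ?_
    exact (continuous_apply (e.symm i)).comp_continuousOn
      (hc.comp (by fun_prop) hmem)
  · intro x hx i hi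
    have := (hm (hmem x hx)).1 (e.symm i)
    simp only [Pi.zero_apply] at this
    simp only [hi]
    linarith
  · intro x hx i hi
    have := (hm (hmem x hx)).2 (e.symm i)
    simp only [Pi.one_apply] at this
    simp only [hi]
    linarith

/-- **Brouwer's fixed point theorem** for the simplex. -/
theorem exists_fixedPoint_of_mapsTo_stdSimplex {M : Type*} [Fintype M] [Nonempty M]
    (h : (M → ℝ) → M → ℝ) (hc : ContinuousOn h (stdSimplex ℝ M))
    (hm : Set.MapsTo h (stdSimplex ℝ M) (stdSimplex ℝ M)) :
    ∃ x ∈ stdSimplex ℝ M, h x = x := by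
  have hcard : (0 : ℝ) < Fintype.card M := by exact_mod_cast Fintype.card_pos
  -- A retraction of the cube onto the simplex: missing mass is spread evenly, excess mass is scaled
  -- away.
  set r : (M → ℝ) → M → ℝ := fun y j =>
    (y j + max 0 (1 - ∑ k, y k) / Fintype.card M) / max 1 (∑ k, y k) with hr
  have hpos : ∀ y : M → ℝ, 0 < max 1 (∑ k, y k) := fun y => lt_max_of_lt_left one_pos
  have hrc : Continuous r := by
    refine continuous_pi fun j => Continuous.div (by fun_prop) (by fun_prop)
      fun y => (hpos y).ne'
  have hrm : ∀ y ∈ Set.Icc (0 : M → ℝ) 1, r y ∈ stdSimplex ℝ M := by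
    intro y hy
    refine ⟨fun j => ?_, ?_⟩
    · have := hy.1 j
      simp only [Pi.zero_apply] at this
      have := hpos y
      simp only [hr]
      positivity
    · simp only [hr]
      rw [← Finset.sum_div, Finset.sum_add_distrib, Finset.sum_const, Finset.card_univ,
        nsmul_eq_mul, mul_div_cancel₀ _ hcard.ne', div_eq_one_iff_eq (hpos y).ne']
      rcases le_total (∑ k, y k) 1 with h1 | h1
      · rw [max_eq_right (by linarith), max_eq_left h1]; ring
      · rw [max_eq_left (by linarith), max_eq_right h1]; ring
  have hsub : stdSimplex ℝ M ⊆ Set.Icc (0 : M → ℝ) 1 := fun x hx =>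
    ⟨hx.1, fun j => (Finset.single_le_sum (fun k _ => hx.1 k) (Finset.mem_univ j)).trans_eq hx.2⟩
  obtain ⟨x, hx, hfix⟩ := exists_fixedPoint_of_mapsTo_Icc (h ∘ r)
    (hc.comp hrc.continuousOn hrm) (fun y hy => hsub (hm (hrm y hy)))
  have hxs : x ∈ stdSimplex ℝ M := hfix ▸ hm (hrm x hx)
  refine ⟨x, hxs, ?_⟩
  have hrx : r x = x := by
    funext j
    simp [hr, hxs.2]
  rwa [Function.comp_apply, hrx] at hfix

/-- A continuous self-map of the simplex that maps each face into itself attains the barycentre. -/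
theorem exists_eq_barycentre_of_preserves_faces {M : Type*} [Fintype M] [Nonempty M]
    (F : (M → ℝ) → M → ℝ) (hc : ContinuousOn F (stdSimplex ℝ M))
    (hm : Set.MapsTo F (stdSimplex ℝ M) (stdSimplex ℝ M))
    (hface : ∀ x ∈ stdSimplex ℝ M, ∀ j, x j = 0 → F x j = 0) :
    ∃ x ∈ stdSimplex ℝ M, ∀ j, F x j = 1 / Fintype.card M := by
  have hcard : (0 : ℝ) < Fintype.card M := by exact_mod_cast Fintype.card_pos
  set u : (M → ℝ) → M → ℝ := fun x j => max 0 (1 / Fintype.card M - F x j) with hu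
  have hu0 : ∀ x j, 0 ≤ u x j := fun x j => le_max_left _ _
  have hU : ∀ x, 0 ≤ ∑ k, u x k := fun x => Finset.sum_nonneg fun k _ => hu0 x k
  have hFj : ∀ j, ContinuousOn (fun x => F x j) (stdSimplex ℝ M) := fun j =>
    (continuous_apply j).comp_continuousOn hc
  have huc : ∀ j, ContinuousOn (fun x => u x j) (stdSimplex ℝ M) := fun j =>
    ContinuousOn.sup continuousOn_const (continuousOn_const.sub (hFj j))
  -- Push `x` towards the coordinates in which `F x` falls short of the barycentre.
  have key := exists_fixedPoint_of_mapsTo_stdSimplex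
    (fun x j => (x j + u x j) / (1 + ∑ k, u x k)) ?_ ?_
  · obtain ⟨x, hx, hfix⟩ := key
    refine ⟨x, hx, ?_⟩
    have hmul : ∀ j, u x j = x j * ∑ k, u x k := by
      intro j
      have := congrFun hfix j
      have hU' := hU x
      rw [div_eq_iff (by positivity)] at this
      linarith
    have hge : ∀ j, 1 / (Fintype.card M : ℝ) ≤ F x j := by
      by_contra! hlt
      obtain ⟨j₀, hj₀⟩ := hlt
      have hpos : 0 < ∑ k, u x k := by
        refine lt_of_lt_of_le ?_ (Finset.single_le_sum (fun k _ => hu0 x k) (Finset.mem_univ j₀))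
        exact lt_max_of_lt_right (by linarith)
      -- One deficit spreads to all coordinates: `x j = 0` would give `u x j = 0` although `F x j =
      -- 0` is a deficit, so `x j > 0` and hence `u x j > 0`. All values of `F x` are then too small
      -- to sum to `1`.
      have hall : ∀ j, F x j < 1 / Fintype.card M := by
        intro j
        have hxj : 0 < x j := by
          refine lt_of_le_of_ne (hx.1 j) fun h => ?_
          have h1 := hmul j
          rw [← h, zero_mul] at h1
          have h2 : 1 / (Fintype.card M : ℝ) - F x j ≤ u x j := le_max_right _ _
          rw [hface x hx j h.symm, h1] at h2
          have : 0 < 1 / (Fintype.card M : ℝ) := by positivity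
          linarith
        have h1 : 0 < u x j := by rw [hmul j]; positivity
        by_contra! h2
        exact h1.ne' (max_eq_left (by linarith))
      have := Finset.sum_lt_sum_of_nonempty Finset.univ_nonempty fun j _ => hall j
      rw [(hm hx).2] at this
      simp [hcard.ne'] at this
    have hsum : ∑ j, (F x j - 1 / Fintype.card M) = 0 := by
      rw [Finset.sum_sub_distrib, (hm hx).2]
      simp [hcard.ne']
    intro j
    have := (Finset.sum_eq_zero_iff_of_nonneg fun j _ => sub_nonneg.2 (hge j)).1 hsum j
      (Finset.mem_univ j)
    linarith
  · refine continuousOn_pi.2 fun j => ContinuousOn.div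
      ((continuous_apply j).continuousOn.add (huc j))
      (continuousOn_const.add (continuousOn_finsetSum _ fun k _ => huc k)) fun x _ => ?_
    have := hU x
    positivity
  · intro x hx
    have hU' := hU x
    refine ⟨fun j => ?_, ?_⟩
    · have h1 := hx.1 j
      have h2 := hu0 x j
      simp only
      positivity
    · rw [← Finset.sum_div, Finset.sum_add_distrib, hx.2, div_self (by positivity)]

/-! ### The colourful Knaster–Kuratowski–Mazurkiewicz theorem -/

/-- Any permutation of positive weight in a Birkhoff decomposition of `A` will do. -/
lemma exists_perm_forall_ne_zero_of_mem_doublyStochastic {M : Type*} [Fintype M] [DecidableEq M]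
    {A : Matrix M M ℝ} (hA : A ∈ doublyStochastic ℝ M) :
    ∃ σ : Equiv.Perm M, ∀ i, A i (σ i) ≠ 0 := by
  obtain ⟨w, hw0, hw1, rfl⟩ := exists_eq_sum_perm_of_mem_doublyStochastic hA
  obtain ⟨σ, -, hσ⟩ := Finset.exists_ne_zero_of_sum_ne_zero (hw1.trans_ne one_ne_zero)
  refine ⟨σ, fun i => ne_of_gt ?_⟩
  rw [Matrix.sum_apply]
  refine lt_of_lt_of_le ?_ (Finset.single_le_sum (fun τ _ => ?_) (Finset.mem_univ σ))
  · simpa [Equiv.Perm.permMatrix, PEquiv.toMatrix_apply] using lt_of_le_of_ne (hw0 σ) hσ.symm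
  · rw [Matrix.smul_apply, smul_eq_mul]
    refine mul_nonneg (hw0 τ) ?_
    simp only [Equiv.Perm.permMatrix, PEquiv.toMatrix_apply]
    split_ifs <;> simp

lemma exists_perm_mem_thickening {M : Type*} [Fintype M] [Nonempty M]
    (C : M → M → Set (M → ℝ)) (hC : ∀ i, ∀ x ∈ stdSimplex ℝ M, ∃ j, 0 < x j ∧ x ∈ C i j)
    {δ : ℝ} (hδ : 0 < δ) :
    ∃ x ∈ stdSimplex ℝ M, ∃ σ : Equiv.Perm M, ∀ i, x ∈ Metric.thickening δ (C i (σ i)) := by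
  classical
  have hcard : (0 : ℝ) < Fintype.card M := by exact_mod_cast Fintype.card_pos
  -- The factor `x j` makes the averaged map preserve faces; the indicator makes a nonzero entry
  -- certify membership in the thickening.
  set g : M → M → (M → ℝ) → ℝ := fun i j x => x j * (thickenedIndicator hδ (C i j) x : ℝ) with hg
  have hg0 : ∀ i j, ∀ x ∈ stdSimplex ℝ M, 0 ≤ g i j x := fun i j x hx =>
    mul_nonneg (hx.1 j) NNReal.zero_le_coe
  have hgc : ∀ i j, Continuous (g i j) := fun i j => (continuous_apply j).mul
    (NNReal.continuous_coe.comp (thickenedIndicator hδ (C i j)).continuous)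
  have hsum : ∀ i, ∀ x ∈ stdSimplex ℝ M, 0 < ∑ l, g i l x := by
    intro i x hx
    obtain ⟨j, hj, hxj⟩ := hC i x hx
    refine Finset.sum_pos' (fun l _ => hg0 i l x hx) ⟨j, Finset.mem_univ j, ?_⟩
    simp only [hg, thickenedIndicator_one hδ _ hxj]
    simpa using hj
  set A : (M → ℝ) → Matrix M M ℝ := fun x i j => g i j x / ∑ l, g i l x with hA
  have hA0 : ∀ x ∈ stdSimplex ℝ M, ∀ i j, 0 ≤ A x i j := fun x hx i j =>
    div_nonneg (hg0 i j x hx) (hsum i x hx).le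
  have hrow : ∀ x ∈ stdSimplex ℝ M, ∀ i, ∑ j, A x i j = 1 := fun x hx i => by
    simp only [hA]
    rw [← Finset.sum_div, div_self (hsum i x hx).ne']
  have key := exists_eq_barycentre_of_preserves_faces
    (fun x j => (∑ i, A x i j) / Fintype.card M) ?_ ?_ ?_
  · obtain ⟨x, hx, hbary⟩ := key
    have hds : A x ∈ doublyStochastic ℝ M := by
      refine mem_doublyStochastic_iff_sum.2 ⟨hA0 x hx, hrow x hx, fun j => ?_⟩
      exact (div_left_inj' hcard.ne').1 (hbary j)
    obtain ⟨σ, hσ⟩ := exists_perm_forall_ne_zero_of_mem_doublyStochastic hds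
    refine ⟨x, hx, σ, fun i => ?_⟩
    by_contra h
    refine hσ i ?_
    simp only [hA, hg, thickenedIndicator_zero hδ _ h]
    simp
  · refine continuousOn_pi.2 fun j => ContinuousOn.div_const
      (continuousOn_finsetSum _ fun i _ => ?_) _
    exact (hgc i j).continuousOn.div (continuous_finsetSum _ fun l _ => hgc i l).continuousOn
      fun x hx => (hsum i x hx).ne'
  · intro x hx
    refine ⟨fun j => div_nonneg (Finset.sum_nonneg fun i _ => hA0 x hx i j) hcard.le, ?_⟩
    rw [← Finset.sum_div, Finset.sum_comm, Finset.sum_congr rfl fun i _ => hrow x hx i]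
    simp [hcard.ne']
  · intro x _ j hj
    simp [hA, hg, hj]

/-- **Gale's colourful KKM theorem.** Given a family of closed covers of the simplex, one for each
`i : N`, each of which covers every point `x` by a set whose index lies in the support of `x`,
there is a point that lies in sets of different indices of the different covers. -/
theorem exists_equiv_forall_mem_of_kkm {N M : Type*} [Fintype N] [Fintype M] [Nonempty M]
    (hcard : Fintype.card N = Fintype.card M) (C : N → M → Set (M → ℝ))
    (hclosed : ∀ i j, IsClosed (C i j))
    (hC : ∀ i, ∀ x ∈ stdSimplex ℝ M, ∃ j, 0 < x j ∧ x ∈ C i j) :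
    ∃ x ∈ stdSimplex ℝ M, ∃ σ : N ≃ M, ∀ i, x ∈ C i (σ i) := by
  classical
  let e : N ≃ M := Fintype.equivOfCardEq hcard
  have happrox : ∀ k : ℕ, ∃ x ∈ stdSimplex ℝ M, ∃ σ : Equiv.Perm M, ∀ i,
      x ∈ Metric.thickening (1 / ((k : ℝ) + 1)) (C (e.symm i) (σ i)) := fun k =>
    exists_perm_mem_thickening (fun i => C (e.symm i)) (fun i => hC (e.symm i))
      Nat.one_div_pos_of_nat
  choose x hx σ hσ using happrox
  -- There are finitely many permutations, so one recurs along a subsequence with mesh tending to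
  -- `0`.
  obtain ⟨τ, hτ⟩ := Finite.exists_infinite_fiber σ
  obtain ⟨φ, hφ, hφτ⟩ := extraction_of_frequently_atTop
    (Nat.frequently_atTop_iff_infinite.2 (Set.infinite_coe_iff.1 hτ))
  obtain ⟨w, hw, ψ, hψ, hlim⟩ := (isCompact_stdSimplex ℝ M).tendsto_subseq fun k => hx (φ k)
  refine ⟨w, hw, e.trans τ, fun i => ?_⟩
  have hz : ∀ k, ∃ z ∈ C i (τ (e i)), dist (x (φ (ψ k))) z < 1 / ((φ (ψ k) : ℝ) + 1) := by
    intro k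
    have h1 := hσ (φ (ψ k)) (e i)
    have h2 : σ (φ (ψ k)) = τ := hφτ (ψ k)
    rw [h2, Equiv.symm_apply_apply] at h1
    exact Metric.mem_thickening_iff.1 h1
  choose z hzC hzx using hz
  refine (hclosed i (τ (e i))).mem_of_tendsto (hlim.congr_dist ?_) (Eventually.of_forall hzC)
  exact squeeze_zero (fun _ => dist_nonneg) (fun k => (hzx k).le)
    (tendsto_one_div_add_atTop_nhds_zero_nat.comp (hφ.comp hψ).tendsto_atTop)

/-! ### Envy-free allocations -/

namespace Demand

variable {M : Type*}

lemma IsContinuous.isClosed [Finite M] {d : Demand M} (hd : d.IsContinuous) (j : M) :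
    IsClosed {p | j ∈ d p} := by
  have := Fintype.ofFinite M
  exact IsSeqClosed.isClosed fun p q hp hq => hd j p q hq hp

lemma CompensableWith.pos [Nonempty M] {T : ℝ} {d : Demand M} (hd : d.CompensableWith T) :
    0 < T := by
  by_contra! hT
  obtain ⟨j, -, hj⟩ := hd (fun _ => T) ⟨Classical.arbitrary M, hT⟩ (by simp [isGreatest_singleton])
  exact lt_irrefl T hj

lemma Miserly.compensableWith {d : Demand M} (hd : d.Miserly) {T : ℝ} (hT : 0 < T) :
    d.CompensableWith T := fun p hp _ =>
  let ⟨j, hj, hpj⟩ := hd p hp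
  ⟨j, hj, hpj.trans_lt hT⟩

/-- At prices of total `R ≤ T` that are at most `T`, a compensable tenant has a best room costing
less than `T`. -/
lemma CompensableWith.exists_lt [Fintype M] [Nonempty M] {R T : ℝ} {d : Demand M}
    (hd : d.CompensableWith T) (hne : d.HasBestRooms) (hR : R ≤ T)
    (hcard : 1 < Fintype.card M) {p : M → ℝ} (hsum : ∑ j, p j = R) (hle : ∀ j, p j ≤ T) :
    ∃ j ∈ d p, p j < T := by
  classical
  by_cases h : ∃ l, p l = T
  · obtain ⟨l, hl⟩ := h
    refine hd p ?_ ⟨⟨l, hl⟩, Set.forall_mem_range.2 hle⟩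
    -- The rooms other than `l` exist since there are at least two, and their prices total `R - T ≤
    -- 0`.
    by_contra! hpos
    have h1 : 0 < ∑ j ∈ Finset.univ.erase l, p j := by
      refine Finset.sum_pos (fun j _ => hpos j) (Finset.card_pos.1 ?_)
      rw [Finset.card_erase_of_mem (Finset.mem_univ l), Finset.card_univ]
      omega
    rw [← Finset.add_sum_erase _ _ (Finset.mem_univ l)] at hsum
    linarith
  · push Not at h
    obtain ⟨j, hj⟩ := hne p
    exact ⟨j, hj, lt_of_le_of_ne (hle j) (h j)⟩

end Demand

/-- Compensable tenants with continuous demands have an envy-free allocation. -/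
theorem exists_isEnvyFree {N M : Type*} [Fintype N] [Fintype M] [Nonempty M]
    (hcard : Fintype.card N = Fintype.card M) {R : ℝ} {D : N → Demand M}
    (hne : ∀ i, (D i).HasBestRooms) (hcont : ∀ i, (D i).IsContinuous) (hcomp : Compensable R D) :
    ∃ (p : M → ℝ) (σ : N ≃ M), IsEnvyFree R D p σ := by
  obtain ⟨T, hR, hT⟩ := hcomp
  -- A single room is treated apart, since then `c = T - R` may be `0`.
  rcases (Nat.one_le_iff_ne_zero.2 Fintype.card_ne_zero : 1 ≤ Fintype.card M).eq_or_lt with h1 | h1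
  · obtain ⟨m, hm⟩ := Fintype.card_eq_one_iff.1 h1.symm
    refine ⟨fun _ => R, Fintype.equivOfCardEq hcard, by simp [← h1], fun i => ?_⟩
    obtain ⟨j, hj⟩ := hne i fun _ => R
    rwa [hm (Fintype.equivOfCardEq hcard i), ← hm j]
  have : Nonempty N := Fintype.card_pos_iff.1 (by omega)
  have hTpos : 0 < T := (hT (Classical.arbitrary N)).pos
  -- The discount to be distributed when all prices start at `T`.
  set c : ℝ := Fintype.card M * T - R with hc
  have hcpos : 0 < c := by
    have : (1 : ℝ) < Fintype.card M := by exact_mod_cast h1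
    nlinarith
  set P : (M → ℝ) → M → ℝ := fun x j => T - c * x j with hP
  have hPc : Continuous P := by fun_prop
  have hPsum : ∀ x ∈ stdSimplex ℝ M, ∑ j, P x j = R := by
    intro x hx
    simp only [hP]
    rw [Finset.sum_sub_distrib, ← Finset.mul_sum, hx.2]
    simp [hc]
  have key := exists_equiv_forall_mem_of_kkm hcard
    (fun i j => P ⁻¹' {p | j ∈ D i p}) (fun i j => ((hcont i).isClosed j).preimage hPc) ?_
  · obtain ⟨x, hx, σ, hσ⟩ := key
    exact ⟨P x, σ, hPsum x hx, hσ⟩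
  · intro i x hx
    obtain ⟨j, hj, hlt⟩ := (hT i).exists_lt (hne i) hR h1 (hPsum x hx) fun j =>
      sub_le_self T (mul_nonneg hcpos.le (hx.1 j))
    refine ⟨j, ?_, hj⟩
    simp only [hP] at hlt
    exact (mul_pos_iff_of_pos_left hcpos).1 (by linarith)

/-! ### Tenants with a preference relation -/

namespace IsPricePreference

variable {M : Type*} {r : M × ℝ → M × ℝ → Prop}

lemma hasBestRooms [Finite M] [Nonempty M] (hr : IsPricePreference r) :
    (Demand.ofPreference r).HasBestRooms := by
  classical
  have := Fintype.ofFinite M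
  intro p
  have key : ∀ s : Finset M, s.Nonempty → ∃ j ∈ s, ∀ k ∈ s, r (j, p j) (k, p k) := by
    intro s hs
    induction hs using Finset.Nonempty.cons_induction with
    | singleton a =>
      exact ⟨a, by simp, fun k hk => by
        rw [Finset.mem_singleton.1 hk]; exact (hr.complete _ _).elim id id⟩
    | cons a s _ _ ih =>
      obtain ⟨j, hj, hmax⟩ := ih
      rcases hr.complete (a, p a) (j, p j) with h | h
      · refine ⟨a, by simp, fun k hk => ?_⟩
        rcases Finset.mem_cons.1 hk with rfl | hk
        · exact (hr.complete _ _).elim id id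
        · exact hr.trans _ _ _ h (hmax k hk)
      · refine ⟨j, by simp [hj], fun k hk => ?_⟩
        rcases Finset.mem_cons.1 hk with rfl | hk
        · exact h
        · exact hmax k hk
  obtain ⟨j, -, hj⟩ := key Finset.univ Finset.univ_nonempty
  exact ⟨j, fun k => hj k (Finset.mem_univ k)⟩

lemma isContinuous (hr : IsPricePreference r) : (Demand.ofPreference r).IsContinuous := by
  intro j p q hpq hj k
  have hlim := tendsto_pi_nhds.1 hpq
  exact (hr.continuous j k).mem_of_tendsto ((hlim j).prodMk_nhds (hlim k))
    (Eventually.of_forall fun n => hj n k)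

/-- If a best room `j` costs `T'`, the chain `(l, p l) ≽ (l, 0) ≽ (j, T) ≽ (j, T')` makes the room
`l` with `p l ≤ 0` a best room too. -/
lemma compensableWith [Finite M] [Nonempty M] (hr : IsPricePreference r) {T T' : ℝ}
    (hT : ArchimedeanWith T r) (hTT' : T ≤ T') (hT' : 0 < T') :
    (Demand.ofPreference r).CompensableWith T' := by
  rintro p ⟨l, hl⟩ ⟨-, hmax⟩
  obtain ⟨j, hj⟩ := hr.hasBestRooms p
  rcases (hmax ⟨j, rfl⟩ : p j ≤ T').lt_or_eq with h | h
  · exact ⟨j, hj, h⟩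
  have hl0 : r (l, p l) (l, 0) := by
    simpa using hr.monotone l (p l) (-p l) (by linarith)
  have hjT : r (j, T) (j, p j) := by
    simpa [h] using hr.monotone j T (T' - T) (by linarith)
  have hlj : r (l, p l) (j, p j) := hr.trans _ _ _ hl0 (hr.trans _ _ _ (hT l j) hjT)
  exact ⟨l, fun k => hr.trans _ _ _ hlj (hj k), hl.trans_lt hT'⟩

end IsPricePreference

/-- The preference relation of the quasilinear tenant with values `v`. -/
def quasilinearPreference {M : Type*} (v : M → ℝ) (a b : M × ℝ) : Prop :=
  v b.1 - b.2 ≤ v a.1 - a.2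

lemma isPricePreference_quasilinearPreference {M : Type*} (v : M → ℝ) :
    IsPricePreference (quasilinearPreference v) where
  complete _ _ := le_total _ _
  trans _ _ _ h₁ h₂ := h₂.trans h₁
  continuous _ _ := isClosed_le (by fun_prop) (by fun_prop)
  monotone j p δ hδ := by
    simp only [quasilinearPreference]
    linarith

lemma archimedeanWith_quasilinearPreference {M : Type*} {v : M → ℝ} {T : ℝ}
    (hT : ∀ j k, v j - v k ≤ T) : ArchimedeanWith T (quasilinearPreference v) := by
  intro j k
  have := hT k j
  simp only [quasilinearPreference]
  linarith

theorem theorem1 {N M : Type*} [Fintype N] [Fintype M] [Nonempty M]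
    (hcard : Fintype.card N = Fintype.card M) (R : ℝ) :
    -- existence of an envy-free allocation
    (∀ D : N → Demand M, (∀ i, (D i).HasBestRooms) → (∀ i, (D i).IsContinuous) →
      Compensable R D → ∃ (p : M → ℝ) (σ : N ≃ M), IsEnvyFree R D p σ) ∧
    -- miserly tenants are covered
    (∀ d : Demand M, d.Miserly → ∀ T : ℝ, 0 < T → d.CompensableWith T) ∧
    -- quasilinear tenants are covered
    (∀ v : M → ℝ, (Demand.quasilinear v).HasBestRooms ∧ (Demand.quasilinear v).IsContinuous ∧
      ∀ T : ℝ, 0 < T → (∀ j k, v j - v k ≤ T) → (Demand.quasilinear v).CompensableWith T) ∧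
    -- Archimedean tenants are covered
    (∀ r : M × ℝ → M × ℝ → Prop, IsPricePreference r →
      (Demand.ofPreference r).HasBestRooms ∧ (Demand.ofPreference r).IsContinuous ∧
      ∀ T T' : ℝ, ArchimedeanWith T r → T ≤ T' → 0 < T' →
        (Demand.ofPreference r).CompensableWith T') := by
  refine ⟨fun D hne hcont hcomp => exists_isEnvyFree hcard hne hcont hcomp,
    fun d hd T hT => hd.compensableWith hT, fun v => ?_, fun r hr =>
      ⟨hr.hasBestRooms, hr.isContinuous, fun T T' hT hTT' hT' => hr.compensableWith hT hTT' hT'⟩⟩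
  -- `Demand.quasilinear v` unfolds to `Demand.ofPreference (quasilinearPreference v)`, so the
  -- results on preferences apply directly.
  have hv := isPricePreference_quasilinearPreference v
  exact ⟨hv.hasBestRooms, hv.isContinuous, fun T hT hvT =>
    hv.compensableWith (archimedeanWith_quasilinearPreference hvT) le_rfl hT⟩
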